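/- Let $\mathbb{F}_q$ be a finite field, let $n \ge 6$ be an integer, and let $G \in \mathbb{F}_q^{3\times n}$ be a systematic MDS matrix: its first three columns form the $3\times 3$ identity matrix, it has rank $3$, and the minimum Hamming weight $d$ of a nonzero vector in its row space satisfies $3+d-1=n$. Let $G^{\nu}$ denote the $\nu$-th column of $G$ and $e_i$ the $i$-th standard basis vector. For $i\in\{1,2,3\}$ let $$\mathcal{R}_i=\{R\subseteq\{1,\dots,n\} : e_i\in\langle G^{\nu} : \nu\in R\rangle_{\mathbb{F}_q}\}$$ be the collection of all recovery sets of the $i$-th object. Let the service rate region $\Lambda(G)\subseteq\mathbb{R}^3$ (with all server capacities equal to $1$) be the set of all $(\lambda_1,\lambda_2,\lambda_3)\in\mathbb{R}^3$ for which there exist real numbers $\lambda_{i,R}\ge 0$ ($i\in\{1,2,3\}$, $R\in\mathcal{R}_i$) such that $$\sum_{R\in\mathcal{R}_i}\lambda_{i,R}=\lambda_i\quad(1\le i\le 3),\qquad \sum_{i=1}^{3}\ \sum_{R\in\mathcal{R}_i,\ \nu\in R}\lambda_{i,R}\le 1\quad(1\le\nu\le n).$$ Then the volume of $\Lambda(G)$,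 that is, the Lebesgue measure of its interior, is $$\operatorname{vol}(\Lambda(G))=\frac{n^3+18n^2+54n-18}{162}.$$ -/

import Mathlib

namespace ServiceRate

/-- The linear code generated by `G`: the span of its rows. -/
def code {F : Type*} [Field F] {k n : ℕ} (G : Matrix (Fin k) (Fin n) F) :
    Submodule F (Fin n → F) :=
  Submodule.span F (Set.range fun i : Fin k => G i)

open Classical in
/-- The minimum Hamming weight of a nonzero codeword
(only meaningful if the code is nonzero). -/
noncomputable def minDist {F : Type*} [Field F] {n : ℕ} (C : Submodule F (Fin n → F)) : ℕ :=
  sInf {w : ℕ | ∃ x ∈ C, x ≠ 0 ∧ hammingNorm x = w}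

/-- `G` is an MDS matrix: it has full rank `k`, and the `[n, k]` code that it generates has
minimum distance `d` with `k + d - 1 = n`. -/
def IsMDS {F : Type*} [Field F] {k n : ℕ} (G : Matrix (Fin k) (Fin n) F) : Prop :=
  G.rank = k ∧ k + minDist (code G) = n + 1

/-- `G` is systematic: its first `k` columns form the identity matrix. -/
def IsSystematic {F : Type*} [Field F] {k n : ℕ} (G : Matrix (Fin k) (Fin n) F) : Prop :=
  ∃ h : k ≤ n, G.submatrix id (Fin.castLE h) = 1

/-- `R` is a recovery set for the `i`-th object: the standard basis vector `e_i` lies in the span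
of the columns of `G` indexed by `R`. -/
def IsRecoverySet {F : Type*} [Field F] {k n : ℕ} (G : Matrix (Fin k) (Fin n) F)
    (i : Fin k) (R : Finset (Fin n)) : Prop :=
  (Pi.single i 1 : Fin k → F) ∈ Submodule.span F {v | ∃ ν ∈ R, v = fun j => G j ν}

open Classical in
/-- The system of all recovery sets of `G`. -/
noncomputable def allRecoverySets {F : Type*} [Field F] {k n : ℕ}
    (G : Matrix (Fin k) (Fin n) F) (i : Fin k) : Finset (Finset (Fin n)) :=
  Finset.univ.filter fun R => IsRecoverySet G i R

/-- The service rate region of the system `𝓡` of recovery sets with server capacity `μ`. In an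
allocation `a`, only the values `a i R` with `R ∈ 𝓡 i` matter. -/
def serviceRateRegion {k n : ℕ} (𝓡 : Fin k → Finset (Finset (Fin n))) (μ : ℝ) :
    Set (Fin k → ℝ) :=
  {lam | ∃ a : Fin k → Finset (Fin n) → ℝ,
    (∀ i, ∑ R ∈ 𝓡 i, a i R = lam i) ∧
    (∀ ν : Fin n, ∑ i, ∑ R ∈ (𝓡 i).filter (fun R => ν ∈ R), a i R ≤ μ) ∧
    (∀ i, ∀ R ∈ 𝓡 i, 0 ≤ a i R)}

/-- The service rate region of `G`: all recovery sets are used, and the server capacity is `1`. -/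
noncomputable def matrixRegion {F : Type*} [Field F] {k n : ℕ}
    (G : Matrix (Fin k) (Fin n) F) : Set (Fin k → ℝ) :=
  serviceRateRegion (allRecoverySets G) 1

/-- The volume of a polytope in `ℝ^k`: the Lebesgue measure of its interior. -/
noncomputable def vol {k : ℕ} (P : Set (Fin k → ℝ)) : ENNReal :=
  MeasureTheory.volume (interior P)

end ServiceRate

namespace ServiceRate

open MeasureTheory

/-! Any three columns form a basis, so a set recovers object `i` exactly when it contains the
systematic column `i` or has at least three elements (`isRecoverySet_iff`). Server `i` can thus
serve object `i` cheaply up to rate 1; every further unit costs three units of capacity, whence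
`load`. Total load at most `n` is clearly necessary. It is sufficient because the excess demand can
be spread over 3-subsets, by the description of the hypersimplex as a convex hull
(`matrixRegion_eq_loadRegion`).

The volume follows by slicing off one coordinate at a time. Each slice sends a truncated power
`s₊^m` to `(s₊^(m+1) - (2/3)(s-1)₊^(m+1))/(m+1)`, so three slices give the expansion of `(1 -
(2/3)·shift)^3` applied to `s₊^3/6`, evaluated at `s = n`. -/

/-! ### Recovery sets of a systematic MDS matrix -/

theorem IsMDS.le_hammingNorm {F : Type*} [Field F] [DecidableEq F] {k n : ℕ}
    {G : Matrix (Fin k) (Fin n) F}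
    (h : IsMDS G) {x : Fin n → F} (hx : x ∈ code G) (h0 : x ≠ 0) :
    n + 1 ≤ k + hammingNorm x := by
  rw [← h.2]
  gcongr
  refine Nat.sInf_le ⟨x, hx, h0, ?_⟩
  congr!

theorem vecMul_mem_code {F : Type*} [Field F] {k n : ℕ} (G : Matrix (Fin k) (Fin n) F)
    (v : Fin k → F) : Matrix.vecMul v G ∈ code G := by
  rw [Matrix.vecMul_eq_sum]
  exact Submodule.sum_mem _ fun i _ => Submodule.smul_mem _ _ (Submodule.subset_span ⟨i, rfl⟩)

/-- Any `k` distinct columns of a systematic MDS matrix with `k` rows are independent. -/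
theorem linearIndependent_columns {F : Type*} [Field F] {k n : ℕ} {G : Matrix (Fin k) (Fin n) F}
    (h : IsMDS G) (hs : IsSystematic G) {c : Fin k → Fin n} (hc : Function.Injective c) :
    LinearIndependent F (fun m j => G j (c m)) := by
  classical
  have hu : IsUnit (G.submatrix id c) := by
    rw [← Matrix.vecMul_injective_iff_isUnit]
    rw [← Matrix.coe_vecMulLinear, injective_iff_map_eq_zero]
    intro v hv
    by_contra hv0
    obtain ⟨hk, hs⟩ := hs
    have hx0 : Matrix.vecMul v G ≠ 0 := by
      intro h0
      apply hv0
      have : Matrix.vecMul v (G.submatrix id (Fin.castLE hk)) = 0 := by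
        ext m
        exact congrFun h0 (Fin.castLE hk m)
      rwa [hs, Matrix.vecMul_one] at this
    have h1 := h.le_hammingNorm (vecMul_mem_code G v) hx0
    -- The codeword vanishes on the `k` chosen positions, so its weight is at most `n - k`, one less
    -- than the minimum distance.
    have h2 : hammingNorm (Matrix.vecMul v G) ≤ (Finset.univ.image c)ᶜ.card := by
      refine Finset.card_le_card fun ν hν => ?_
      simp only [Finset.mem_filter, Finset.mem_univ, true_and] at hν
      simp only [Finset.mem_compl, Finset.mem_image, Finset.mem_univ, true_and, not_exists]
      rintro m rfl
      exact hν (congrFun hv m)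
    rw [Finset.card_compl, Finset.card_image_of_injective _ hc] at h2
    simp only [Fintype.card_fin, Finset.card_univ] at h2
    omega
  exact Matrix.linearIndependent_cols_iff_isUnit.2 hu

theorem exists_injective_range_subset {n : ℕ} {R : Finset (Fin n)} {k : ℕ} (h : k ≤ R.card) :
    ∃ c : Fin k → Fin n, Function.Injective c ∧ ∀ m, c m ∈ R := by
  obtain ⟨T, hT, hk⟩ := Finset.exists_subset_card_eq h
  exact ⟨fun m => (T.equivFinOfCardEq hk).symm m,
    Subtype.val_injective.comp (Equiv.injective _), fun m => hT (Subtype.prop _)⟩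

theorem isRecoverySet_iff {F : Type*} [Field F] {k n : ℕ} {G : Matrix (Fin k) (Fin n) F}
    (h : IsMDS G) (hs : IsSystematic G) (hk : k ≤ n) (i : Fin k) (R : Finset (Fin n)) :
    IsRecoverySet G i R ↔ Fin.castLE hk i ∈ R ∨ k ≤ R.card := by
  classical
  have hcol : (fun j => G j (Fin.castLE hk i)) = (Pi.single i 1 : Fin k → F) := by
    obtain ⟨_, hs⟩ := hs
    ext j
    have := congrFun (congrFun hs j) i
    simpa [Matrix.one_apply, Pi.single_apply] using this
  constructor
  · intro hR
    by_contra! hcon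
    obtain ⟨hi, hR3⟩ := hcon
    have hcard : (insert (Fin.castLE hk i) R).card ≤ k := by
      rw [Finset.card_insert_of_notMem hi]; omega
    -- Padding `R ∪ {i}` to `k` independent columns keeps column `i` out of the span of `R`.
    obtain ⟨T, hT, hTk⟩ := Finset.exists_superset_card_eq hcard (by simpa using hk)
    let e := T.equivFinOfCardEq hTk
    have hli := linearIndependent_columns h hs (c := fun m => (e.symm m : Fin n))
      (Subtype.val_injective.comp e.symm.injective)
    have hiT : Fin.castLE hk i ∈ T := hT (Finset.mem_insert_self _ _)
    refine hli.notMem_span_image (s := {m | (e.symm m : Fin n) ∈ R}) (x := e ⟨_, hiT⟩)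
      (by simpa using hi) ?_
    simp only [Equiv.symm_apply_apply]
    rw [hcol]
    refine Submodule.span_mono ?_ hR
    rintro v ⟨ν, hν, rfl⟩
    exact ⟨e ⟨ν, hT (Finset.mem_insert_of_mem hν)⟩, by simpa using hν, by simp⟩
  · rintro (hi | hR)
    · exact Submodule.subset_span ⟨_, hi, hcol.symm⟩
    · obtain ⟨c, hc, hcR⟩ := exists_injective_range_subset hR
      have hli := linearIndependent_columns h hs hc
      have htop := hli.span_eq_top_of_card_eq_finrank' (by simp)
      refine Submodule.span_mono ?_ (htop ▸ Submodule.mem_top :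
        (Pi.single i 1 : Fin k → F) ∈ Submodule.span F (Set.range fun m j => G j (c m)))
      rintro v ⟨m, rfl⟩
      exact ⟨c m, hcR m, rfl⟩

/-! ### Marginals of distributions on `k`-subsets -/

/-- A point of the hypersimplex is the vector of marginals of a probability distribution on the
subsets of size `k`. -/
theorem exists_weights_of_sum_eq {ι : Type*} [Fintype ι] [DecidableEq ι] (k : ℕ) (p : ι → ℝ)
    (h0 : ∀ i, 0 ≤ p i) (h1 : ∀ i, p i ≤ 1) (hp : ∑ i, p i = k) :
    ∃ w : Finset ι → ℝ, (∀ s, 0 ≤ w s) ∧ (∀ s, s.card ≠ k → w s = 0) ∧ ∑ s, w s = 1 ∧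
      ∀ i, ∑ s with i ∈ s, w s = p i := by
  induction hN : (Finset.univ.filter fun i => p i ≠ 0 ∧ p i ≠ 1).card using Nat.strong_induction_on
    generalizing p with
  | _ N ih =>
  by_cases hfrac : ∃ i, p i ≠ 0 ∧ p i ≠ 1
  · obtain ⟨i, hi0, hi1⟩ := hfrac
    -- The sum is an integer, so a fractional coordinate cannot be the only one.
    obtain ⟨j, hij, hj0, hj1⟩ : ∃ j, j ≠ i ∧ p j ≠ 0 ∧ p j ≠ 1 := by
      by_contra! hcon
      have hint : ∀ j ∈ Finset.univ.erase i, p j = ((if p j = 0 then 0 else 1 : ℕ) : ℝ) := by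
        intro j hj
        split_ifs with hj0
        · simpa using hj0
        · simpa using hcon j (Finset.ne_of_mem_erase hj) hj0
      rw [← Finset.add_sum_erase _ _ (Finset.mem_univ i), Finset.sum_congr rfl hint,
        ← Nat.cast_sum] at hp
      set m := ∑ j ∈ Finset.univ.erase i, (if p j = 0 then 0 else 1 : ℕ)
      have hlt0 : (m : ℝ) < k := by
        have := lt_of_le_of_ne (h0 i) (Ne.symm hi0); linarith
      have hlt1 : (k : ℝ) < (m + 1 : ℕ) := by
        have := lt_of_le_of_ne (h1 i) hi1; push_cast; linarith
      rw [Nat.cast_lt] at hlt0 hlt1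
      omega
    -- Mass moves from `b` to `a` until one of them becomes integral, which lowers the number of
    -- fractional coordinates. Moving in both directions puts `p` on a segment between two solved
    -- points.
    have move : ∀ a b : ι, a ≠ b → p a ≠ 0 → p a ≠ 1 → p b ≠ 0 → p b ≠ 1 →
        ∃ t : ℝ, 0 < t ∧ ∃ w : Finset ι → ℝ, (∀ s, 0 ≤ w s) ∧ (∀ s, s.card ≠ k → w s = 0) ∧
          ∑ s, w s = 1 ∧ ∀ l, ∑ s with l ∈ s, w s =
            p l + t * ((if l = a then 1 else 0) - (if l = b then 1 else 0)) := by
      intro a b hab ha0 ha1 hb0 hb1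
      have ha0' := lt_of_le_of_ne (h0 a) (Ne.symm ha0)
      have ha1' := lt_of_le_of_ne (h1 a) ha1
      have hb0' := lt_of_le_of_ne (h0 b) (Ne.symm hb0)
      have hb1' := lt_of_le_of_ne (h1 b) hb1
      set t := min (1 - p a) (p b) with ht
      have hta : t ≤ 1 - p a := min_le_left _ _
      have htb : t ≤ p b := min_le_right _ _
      have htpos : 0 < t := lt_min (by linarith) hb0'
      let q : ι → ℝ := fun l => p l + t * ((if l = a then 1 else 0) - (if l = b then 1 else 0))
      have hqa : q a = p a + t := by simp [q, hab]
      have hqb : q b = p b - t := by simp [q, hab.symm, sub_eq_add_neg]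
      have hql : ∀ l, l ≠ a → l ≠ b → q l = p l := fun l h1 h2 => by simp [q, h1, h2]
      refine ⟨t, htpos, ih _ ?_ q ?_ ?_ ?_ rfl⟩
      · rw [← hN]
        have hend : q a = 1 ∨ q b = 0 := by
          rcases min_choice (1 - p a) (p b) with h | h
          · left; rw [hqa, ht, h]; ring
          · right; rw [hqb, ht, h]; ring
        refine Finset.card_lt_card ((Finset.ssubset_iff_of_subset ?_).2 ?_)
        · intro l hl
          simp only [Finset.mem_filter, Finset.mem_univ, true_and] at hl ⊢
          by_cases hla : l = a
          · subst hla; exact ⟨ha0, ha1⟩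
          by_cases hlb : l = b
          · subst hlb; exact ⟨hb0, hb1⟩
          rwa [hql l hla hlb] at hl
        · rcases hend with h | h
          · exact ⟨a, by simp [ha0, ha1], by simp [h]⟩
          · exact ⟨b, by simp [hb0, hb1], by simp [h]⟩
      · intro l
        by_cases hla : l = a
        · subst hla; rw [hqa]; linarith
        by_cases hlb : l = b
        · subst hlb; rw [hqb]; linarith
        rw [hql l hla hlb]; exact h0 l
      · intro l
        by_cases hla : l = a
        · subst hla; rw [hqa]; linarith
        by_cases hlb : l = b
        · subst hlb; rw [hqb]; linarith
        rw [hql l hla hlb]; exact h1 l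
      · simp only [q, Finset.sum_add_distrib, ← Finset.mul_sum, Finset.sum_sub_distrib]
        simp [hp]
    obtain ⟨t, ht, w, hw0, hwk, hw1, hwp⟩ := move i j hij.symm hi0 hi1 hj0 hj1
    obtain ⟨u, hu, v, hv0, hvk, hv1, hvp⟩ := move j i hij hj0 hj1 hi0 hi1
    have htu : t + u ≠ 0 := by positivity
    refine ⟨fun s => u / (t + u) * w s + t / (t + u) * v s, fun s => ?_, fun s hs => ?_, ?_,
      fun l => ?_⟩
    · have := hw0 s; have := hv0 s; positivity
    · simp [hwk s hs, hvk s hs]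
    · rw [Finset.sum_add_distrib, ← Finset.mul_sum, ← Finset.mul_sum, hw1, hv1]
      field_simp; ring
    · rw [Finset.sum_add_distrib, ← Finset.mul_sum, ← Finset.mul_sum, hwp, hvp]
      field_simp; ring
  · push Not at hfrac
    have hp' : ∀ i, p i = if p i = 1 then 1 else 0 := by
      intro i
      split_ifs with h
      · exact h
      · by_contra h'; exact h (hfrac i h')
    let S : Finset ι := Finset.univ.filter fun i => p i = 1
    have hS : S.card = k := by
      rw [Finset.sum_congr rfl fun i _ => hp' i, Finset.sum_boole] at hp
      exact_mod_cast hp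
    refine ⟨fun s => if s = S then 1 else 0, fun s => by positivity, fun s hs => ?_, by simp,
      fun i => ?_⟩
    · have : s ≠ S := fun h => hs (h ▸ hS)
      simp [this]
    · rw [Finset.sum_ite_eq', hp' i]
      simp [S]

/-- No marginal can exceed the total mass `Y`, so capacities are cut off at `Y`; scaling them down
to sum `k * Y` and dividing by `Y` gives a point of the hypersimplex. -/
theorem exists_weights_of_le_sum_min {ι : Type*} [Fintype ι] [DecidableEq ι] (k : ℕ) (c : ι → ℝ)
    (Y : ℝ) (hc : ∀ i, 0 ≤ c i) (hY : 0 ≤ Y) (h : k * Y ≤ ∑ i, min (c i) Y) :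
    ∃ w : Finset ι → ℝ, (∀ s, 0 ≤ w s) ∧ (∀ s, s.card ≠ k → w s = 0) ∧ ∑ s, w s = Y ∧
      ∀ i, ∑ s with i ∈ s, w s ≤ c i := by
  rcases hY.eq_or_lt with rfl | hY'
  · exact ⟨0, by simp, by simp, by simp, by simpa using hc⟩
  set S := ∑ i, min (c i) Y with hS
  have hmin : ∀ i, 0 ≤ min (c i) Y := fun i => le_min (hc i) hY
  obtain ⟨r, hr0, hr1, hrS⟩ : ∃ r : ℝ, 0 ≤ r ∧ r ≤ 1 ∧ r * S = k * Y := by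
    rcases (Finset.sum_nonneg fun i _ => hmin i : 0 ≤ S).eq_or_lt with h0 | h0
    · refine ⟨0, le_rfl, zero_le_one, ?_⟩
      have : 0 ≤ k * Y := by positivity
      linarith
    · exact ⟨k * Y / S, by positivity, (div_le_one h0).2 h, div_mul_cancel₀ _ h0.ne'⟩
  obtain ⟨w, hw0, hwk, hw1, hwp⟩ := exists_weights_of_sum_eq k (fun i => r * min (c i) Y / Y)
    (fun i => by have := hmin i; positivity)
    (fun i => (div_le_one hY').2 <|
      (mul_le_of_le_one_left (hmin i) hr1).trans (min_le_right _ _))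
    (by rw [← Finset.sum_div, ← Finset.mul_sum, ← hS, hrS]; field_simp)
  refine ⟨fun s => Y * w s, fun s => mul_nonneg hY (hw0 s), fun s hs => by simp [hwk s hs], ?_,
    fun i => ?_⟩
  · rw [← Finset.mul_sum, hw1, mul_one]
  · rw [← Finset.mul_sum, hwp, mul_div_cancel₀ _ hY'.ne']
    exact (mul_le_of_le_one_left (hmin i) hr1).trans (min_le_left _ _)

/-! ### The service rate region in terms of loads -/

/-- The server capacity that is used up by serving an object of an MDS system of dimension `3` at
rate `t`: one unit each up to rate `1`, and three units each beyond. -/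
noncomputable def load (t : ℝ) : ℝ := max t (3 * t - 2)

/-- The rates whose total load is at most `s`. -/
def loadRegion (k : ℕ) (s : ℝ) : Set (Fin k → ℝ) :=
  {lam | (∀ i, 0 ≤ lam i) ∧ ∑ i, load (lam i) ≤ s}

theorem load_eq_min_add (t : ℝ) : load t = min t 1 + 3 * (t - min t 1) := by
  unfold load
  rcases le_total t 1 with h | h
  · rw [min_eq_left h, max_eq_left (by linarith)]; ring
  · rw [min_eq_right h, max_eq_right (by linarith)]; ring

/-- Double counting of the used capacity: `R` costs `|R| ≥ 3 - 2·[i ∈ R]`, and the sets through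
server `i` carry rate at most 1. -/
theorem mem_loadRegion_of_mem_serviceRateRegion {n : ℕ} (h3 : 3 ≤ n)
    {𝓡 : Fin 3 → Finset (Finset (Fin n))}
    (h𝓡 : ∀ i R, R ∈ 𝓡 i ↔ Fin.castLE h3 i ∈ R ∨ 3 ≤ R.card) {lam : Fin 3 → ℝ}
    (h : lam ∈ serviceRateRegion 𝓡 1) : lam ∈ loadRegion 3 n := by
  obtain ⟨a, hsum, hcap, ha⟩ := h
  refine ⟨fun i => hsum i ▸ Finset.sum_nonneg (ha i), ?_⟩
  have hx : ∀ i, ∑ R ∈ 𝓡 i with Fin.castLE h3 i ∈ R, a i R ≤ 1 := fun i =>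
    (Finset.single_le_sum (f := fun j => ∑ R ∈ 𝓡 j with Fin.castLE h3 i ∈ R, a j R)
      (fun j _ => Finset.sum_nonneg fun R hR => ha j R (Finset.mem_filter.1 hR).1)
      (Finset.mem_univ i)).trans (hcap _)
  have key : ∀ i, load (lam i) ≤ ∑ R ∈ 𝓡 i, R.card * a i R := by
    intro i
    refine max_le ?_ ?_
    · rw [← hsum i]
      refine Finset.sum_le_sum fun R hR => le_mul_of_one_le_left (ha i R hR) ?_
      have : 1 ≤ R.card := by
        rcases (h𝓡 i R).1 hR with h | h
        · exact Finset.card_pos.2 ⟨_, h⟩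
        · omega
      exact_mod_cast this
    · have : ∑ R ∈ 𝓡 i, (3 * a i R - 2 * if Fin.castLE h3 i ∈ R then a i R else 0) ≤
          ∑ R ∈ 𝓡 i, R.card * a i R := by
        refine Finset.sum_le_sum fun R hR => ?_
        have h0 := ha i R hR
        split_ifs with hi
        · have : (1 : ℝ) ≤ R.card := by exact_mod_cast Finset.card_pos.2 ⟨_, hi⟩
          nlinarith
        · have : (3 : ℝ) ≤ R.card := by exact_mod_cast ((h𝓡 i R).1 hR).resolve_left hi
          nlinarith
      rw [Finset.sum_sub_distrib, ← Finset.mul_sum, ← Finset.mul_sum, hsum,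
        ← Finset.sum_filter] at this
      linarith [hx i]
  calc ∑ i, load (lam i) ≤ ∑ i, ∑ R ∈ 𝓡 i, R.card * a i R := Finset.sum_le_sum fun i _ => key i
    _ = ∑ ν : Fin n, ∑ i, ∑ R ∈ 𝓡 i with ν ∈ R, a i R := by
      rw [Finset.sum_comm]
      refine Finset.sum_congr rfl fun i _ => ?_
      simp_rw [Finset.sum_filter]
      rw [Finset.sum_comm]
      refine Finset.sum_congr rfl fun R _ => ?_
      rw [← Finset.sum_filter]
      simp
    _ ≤ ∑ ν : Fin n, (1 : ℝ) := Finset.sum_le_sum fun ν _ => hcap ν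
    _ = n := by simp

theorem mem_serviceRateRegion_of_mem_loadRegion {n : ℕ} (h3 : 3 ≤ n) (h6 : 6 ≤ n)
    {𝓡 : Fin 3 → Finset (Finset (Fin n))}
    (h𝓡 : ∀ i R, R ∈ 𝓡 i ↔ Fin.castLE h3 i ∈ R ∨ 3 ≤ R.card) {lam : Fin 3 → ℝ}
    (h : lam ∈ loadRegion 3 n) : lam ∈ serviceRateRegion 𝓡 1 := by
  obtain ⟨hlam, hload⟩ := h
  set x : Fin 3 → ℝ := fun i => min (lam i) 1 with hx
  set y : Fin 3 → ℝ := fun i => lam i - x i with hy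
  have hx0 : ∀ i, 0 ≤ x i := fun i => le_min (hlam i) zero_le_one
  have hx1 : ∀ i, x i ≤ 1 := fun i => min_le_right _ _
  have hy0 : ∀ i, 0 ≤ y i := fun i => sub_nonneg.2 (min_le_left _ _)
  set Y := ∑ i, y i with hY
  have hY0 : 0 ≤ Y := Finset.sum_nonneg fun i _ => hy0 i
  set d : Fin n → ℝ := fun ν => ∑ i, if ν = Fin.castLE h3 i then x i else 0 with hd
  have hd0 : ∀ ν, 0 ≤ d ν := fun ν => Finset.sum_nonneg fun i _ => by
    split_ifs
    exacts [hx0 i, le_rfl]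
  have hdi : ∀ i, d (Fin.castLE h3 i) = x i := fun i => by simp [hd]
  have hdn : ∀ ν, (∀ i, ν ≠ Fin.castLE h3 i) → d ν = 0 := fun ν hν => by simp [hd, hν]
  have hd1 : ∀ ν, d ν ≤ 1 := by
    intro ν
    by_cases hν : ∃ i, ν = Fin.castLE h3 i
    · obtain ⟨i, rfl⟩ := hν; rw [hdi]; exact hx1 i
    · push Not at hν; rw [hdn ν hν]; exact zero_le_one
  have hdsum : ∑ ν, d ν = ∑ i, x i := by rw [hd, Finset.sum_comm]; simp
  -- For `Y ≥ 1` the cutoff is inactive and this is the load bound. For `Y ≤ 1` the `n - 3 ≥ 3`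
  -- nonsystematic servers, still entirely free, suffice.
  have hfeas : (3 : ℕ) * Y ≤ ∑ ν, min (1 - d ν) Y := by
    rcases le_total 1 Y with h1 | h1
    · rw [Finset.sum_congr rfl fun ν _ =>
        min_eq_left (show 1 - d ν ≤ Y by linarith [hd0 ν]), Finset.sum_sub_distrib, hdsum]
      simp only [load_eq_min_add, Finset.sum_add_distrib, ← Finset.mul_sum] at hload
      simp only [Finset.sum_const, Finset.card_univ, Fintype.card_fin, nsmul_eq_mul, mul_one]
      push_cast
      change ∑ i, x i + 3 * Y ≤ n at hload
      linarith
    · set T : Finset (Fin n) := (Finset.univ.image (Fin.castLE h3))ᶜ with hT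
      have hTcard : 3 ≤ T.card := by
        rw [hT, Finset.card_compl, Finset.card_image_of_injective _ (Fin.castLE_injective h3)]
        simp only [Fintype.card_fin, Finset.card_univ]
        omega
      calc ((3 : ℕ) : ℝ) * Y ≤ T.card * Y := by gcongr
        _ = ∑ ν ∈ T, min (1 - d ν) Y := by
          rw [Finset.sum_congr rfl (g := fun _ => Y), Finset.sum_const, nsmul_eq_mul]
          intro ν hν
          rw [hdn ν, sub_zero, min_eq_right h1]
          rintro i rfl
          simp [hT] at hν
        _ ≤ _ := Finset.sum_le_sum_of_subset_of_nonneg (Finset.subset_univ _) fun ν _ _ =>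
          le_min (by linarith [hd1 ν]) hY0
  obtain ⟨w, hw0, hwk, hwY, hwc⟩ := exists_weights_of_le_sum_min 3 (fun ν => 1 - d ν) Y
    (fun ν => by linarith [hd1 ν]) hY0 hfeas
  -- If `Y = 0`, every `y i` vanishes, so the convention `y i / 0 = 0` is harmless.
  have hyY : ∀ i, y i / Y * Y = y i := by
    intro i
    rcases eq_or_ne Y 0 with h0 | h0
    · have := (Finset.sum_eq_zero_iff_of_nonneg fun i _ => hy0 i).1 (hY ▸ h0) i (Finset.mem_univ i)
      simp [this]
    · exact div_mul_cancel₀ _ h0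
  refine ⟨fun i R => (if R = {Fin.castLE h3 i} then x i else 0) + y i / Y * w R, fun i => ?_,
    fun ν => ?_, fun i R _ => ?_⟩
  · rw [Finset.sum_add_distrib, Finset.sum_ite_eq', if_pos ((h𝓡 _ _).2 (by simp)),
      ← Finset.mul_sum, Finset.sum_subset (Finset.subset_univ (𝓡 i)), hwY, hyY]
    · simp [hy]
    · intro R _ hR
      refine hwk R fun hR3 => hR ((h𝓡 _ _).2 (Or.inr hR3.ge))
  · have hle : ∀ i, ∑ R ∈ 𝓡 i with ν ∈ R,
        ((if R = {Fin.castLE h3 i} then x i else 0) + y i / Y * w R) ≤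
          (if ν = Fin.castLE h3 i then x i else 0) + y i / Y * ∑ R with ν ∈ R, w R := by
      intro i
      have hyY0 : 0 ≤ y i / Y := div_nonneg (hy0 i) hY0
      rw [Finset.sum_add_distrib, Finset.sum_ite_eq', ← Finset.mul_sum]
      refine add_le_add ?_ (mul_le_mul_of_nonneg_left
        (Finset.sum_le_sum_of_subset_of_nonneg (Finset.filter_subset_filter _
          (Finset.subset_univ _)) fun R _ _ => hw0 R) hyY0)
      by_cases hν : ν = Fin.castLE h3 i
      · rw [if_pos hν]
        split_ifs
        exacts [le_rfl, hx0 i]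
      · simp [hν]
    have hw : 0 ≤ ∑ R with ν ∈ R, w R := Finset.sum_nonneg fun R _ => hw0 R
    have hYY : ∑ i, y i / Y ≤ 1 := by
      rw [← Finset.sum_div, ← hY]; exact div_self_le_one Y
    calc _ ≤ ∑ i, _ := Finset.sum_le_sum fun i _ => hle i
      _ = d ν + (∑ i, y i / Y) * ∑ R with ν ∈ R, w R := by
        rw [Finset.sum_add_distrib, ← Finset.sum_mul]
      _ ≤ d ν + 1 * (1 - d ν) := by
        gcongr
        exact hwc ν
      _ = 1 := by ring
  · have := hw0 R
    have := hy0 i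
    have := hx0 i
    positivity

/-- The service rate region of a systematic MDS matrix with three rows. -/
theorem matrixRegion_eq_loadRegion {F : Type*} [Field F] {n : ℕ} (hn : 6 ≤ n)
    {G : Matrix (Fin 3) (Fin n) F} (h : IsMDS G) (hs : IsSystematic G) :
    matrixRegion G = loadRegion 3 n := by
  have h3 : 3 ≤ n := by omega
  have h𝓡 : ∀ i R, R ∈ allRecoverySets G i ↔ Fin.castLE h3 i ∈ R ∨ 3 ≤ R.card := fun i R => by
    simp only [allRecoverySets, Finset.mem_filter, Finset.mem_univ, true_and,
      isRecoverySet_iff h hs h3]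
  exact Set.Subset.antisymm (fun _ => mem_loadRegion_of_mem_serviceRateRegion h3 h𝓡)
    fun _ => mem_serviceRateRegion_of_mem_loadRegion h3 hn h𝓡

/-! ### Convexity and slicing of load regions -/

theorem continuous_load : Continuous load := by unfold load; fun_prop

theorem le_load (t : ℝ) : t ≤ load t := le_max_left _ _

theorem convexOn_load : ConvexOn ℝ Set.univ load :=
  (convexOn_id convex_univ).sup <|
    ((convexOn_id convex_univ).smul (by norm_num : (0 : ℝ) ≤ 3)).add_const (-2)

theorem isClosed_loadRegion (k : ℕ) (s : ℝ) : IsClosed (loadRegion k s) := by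
  refine IsClosed.inter (s₁ := {lam : Fin k → ℝ | ∀ i, 0 ≤ lam i}) ?_ ?_
  · simp only [Set.ofPred_forall]
    exact isClosed_iInter fun i => isClosed_le continuous_const (continuous_apply i)
  · exact isClosed_le (continuous_finsetSum _ fun i _ =>
      continuous_load.comp (continuous_apply i)) continuous_const

theorem convex_loadRegion (k : ℕ) (s : ℝ) : Convex ℝ (loadRegion k s) := by
  intro u hu v hv a b ha hb hab
  refine ⟨fun i => ?_, ?_⟩
  · have := hu.1 i
    have := hv.1 i
    simp only [Pi.add_apply, Pi.smul_apply, smul_eq_mul]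
    positivity
  · calc ∑ i, load ((a • u + b • v) i) ≤ ∑ i, (a * load (u i) + b * load (v i)) :=
          Finset.sum_le_sum fun i _ =>
            convexOn_load.2 (Set.mem_univ _) (Set.mem_univ _) ha hb hab
      _ = a * ∑ i, load (u i) + b * ∑ i, load (v i) := by
        rw [Finset.sum_add_distrib, Finset.mul_sum, Finset.mul_sum]
      _ ≤ a * s + b * s := by gcongr; exacts [hu.2, hv.2]
      _ = s := by rw [← add_mul, hab, one_mul]

theorem vol_loadRegion (k : ℕ) (s : ℝ) : vol (loadRegion k s) = volume (loadRegion k s) :=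
  measure_congr (interior_ae_eq_of_null_frontier ((convex_loadRegion k s).addHaar_frontier _))

theorem cons_mem_loadRegion {k : ℕ} {s t : ℝ} {u : Fin k → ℝ} :
    (Fin.cons t u : Fin (k + 1) → ℝ) ∈ loadRegion (k + 1) s ↔
      0 ≤ t ∧ u ∈ loadRegion k (s - load t) := by
  simp only [loadRegion, Set.mem_ofPred_eq, Fin.forall_fin_succ, Fin.cons_zero, Fin.cons_succ,
    Fin.sum_univ_succ, le_sub_iff_add_le', and_assoc]

theorem volume_loadRegion_succ (k : ℕ) (s : ℝ) :
    volume (loadRegion (k + 1) s) =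
      ∫⁻ t in Set.Ici (0 : ℝ), volume (loadRegion k (s - load t)) := by
  have hmp := (volume_preserving_piFinSuccAbove (fun _ : Fin (k + 1) => ℝ) 0).symm
  have hmeas := (isClosed_loadRegion (k + 1) s).measurableSet
  rw [← hmp.measure_preimage hmeas.nullMeasurableSet, Measure.volume_eq_prod,
    Measure.prod_apply (hmp.measurable hmeas), ← lintegral_indicator measurableSet_Ici]
  refine lintegral_congr fun t => ?_
  have hpre : Prod.mk t ⁻¹' ((MeasurableEquiv.piFinSuccAbove (fun _ : Fin (k + 1) => ℝ) 0).symm ⁻¹'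
      loadRegion (k + 1) s) = {u | 0 ≤ t ∧ u ∈ loadRegion k (s - load t)} := by
    ext u
    simp only [Set.mem_preimage, Set.mem_ofPred_eq, ← cons_mem_loadRegion]
    simp [MeasurableEquiv.piFinSuccAbove_symm_apply, Fin.insertNthEquiv]
  rw [hpre]
  by_cases ht : 0 ≤ t
  · rw [Set.indicator_of_mem (Set.mem_Ici.2 ht)]
    simp [ht]
  · rw [Set.indicator_of_notMem (by simpa using ht)]
    simp [ht]

theorem loadRegion_eq_empty {k : ℕ} {s : ℝ} (hs : s < 0) : loadRegion k s = ∅ := by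
  ext u
  simp only [Set.mem_empty_iff_false, iff_false]
  rintro ⟨h0, h⟩
  have : 0 ≤ ∑ i, load (u i) := Finset.sum_nonneg fun i _ => (h0 i).trans (le_load _)
  linarith

/-- Slices at `t > M` are empty because `load t ≥ t > s`, so the half-line may be replaced by a
bounded interval. -/
theorem volume_loadRegion_succ_of_eq {k : ℕ} {W : ℝ → ℝ} (hW : Continuous W) (hW0 : ∀ s, 0 ≤ W s)
    (h : ∀ s, volume (loadRegion k s) = ENNReal.ofReal (W s)) {s M : ℝ} (hM : 0 ≤ M) (hs : s ≤ M) :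
    volume (loadRegion (k + 1) s) = ENNReal.ofReal (∫ t in 0..M, W (s - load t)) := by
  have hcont : Continuous fun t => W (s - load t) :=
    hW.comp (continuous_const.sub continuous_load)
  rw [volume_loadRegion_succ, intervalIntegral.integral_of_le hM,
    ofReal_integral_eq_lintegral_ofReal (hcont.integrableOn_Ioc)
      (Filter.Eventually.of_forall fun t => hW0 _), setLIntegral_congr Ioi_ae_eq_Ici.symm,
    ← lintegral_indicator measurableSet_Ioi, ← lintegral_indicator measurableSet_Ioc]
  refine lintegral_congr fun t => ?_
  simp only [Set.indicator_apply, Set.mem_Ioi, Set.mem_Ioc]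
  by_cases ht : 0 < t
  · by_cases htM : t ≤ M
    · simp [ht, htM, h]
    · simp [ht, htM, loadRegion_eq_empty (show s - load t < 0 by linarith [le_load t])]
  · simp [ht]

/-! ### Integrals of truncated powers -/

theorem hasDerivAt_max_pow (k : ℕ) (x : ℝ) :
    HasDerivAt (fun x : ℝ => max x 0 ^ (k + 2)) ((k + 2) * max x 0 ^ (k + 1)) x := by
  rcases lt_trichotomy x 0 with h | rfl | h
  · rw [max_eq_right h.le]
    refine ((hasDerivAt_const x (0 : ℝ)).congr_of_eventuallyEq ?_).congr_deriv (by simp)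
    filter_upwards [eventually_lt_nhds h] with y hy
    simp [max_eq_right hy.le]
  · rw [hasDerivAt_iff_isLittleO]
    simpa using (Asymptotics.IsBigO.of_bound' (.of_forall fun y : ℝ => by
      rw [norm_pow, norm_pow]
      gcongr
      rw [Real.norm_of_nonneg (le_max_right _ _)]
      exact max_le (le_abs_self y) (abs_nonneg y))).trans_isLittleO
      (Asymptotics.isLittleO_pow_id (𝕜 := ℝ) (show 1 < k + 2 by omega))
  · rw [max_eq_left h.le]
    refine ((hasDerivAt_pow (k + 2) x).congr_of_eventuallyEq ?_).congr_deriv (by simp)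
    filter_upwards [eventually_gt_nhds h] with y hy
    simp [max_eq_left hy.le]

theorem integral_max_pow (k : ℕ) {c s : ℝ} (hc : c ≠ 0) (a b : ℝ) :
    ∫ t in a..b, max (s - c * t) 0 ^ (k + 1) =
      (max (s - c * a) 0 ^ (k + 2) - max (s - c * b) 0 ^ (k + 2)) / (c * (k + 2)) := by
  have hk : (k + 2 : ℝ) ≠ 0 := by positivity
  rw [intervalIntegral.integral_eq_sub_of_hasDerivAt
    (f := fun t => - max (s - c * t) 0 ^ (k + 2) / (c * (k + 2)))]
  · ring
  · intro t _
    have h1 : HasDerivAt (fun t => s - c * t) (-c) t := by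
      simpa using ((hasDerivAt_id t).const_mul c).const_sub s
    have h2 := ((hasDerivAt_max_pow k (s - c * t)).comp t h1).neg.div_const (c * (k + 2))
    refine h2.congr_deriv ?_
    field_simp
  · exact Continuous.intervalIntegrable (by fun_prop) _ _

/-- The integral splits at the kink `t = 1`. There the slope-1 piece contributes `-1` and the
slope-3 piece `+1/3`, hence `-2/3`; the term at `M` vanishes since `s + 2 ≤ 3 * M`. -/
theorem integral_max_sub_load_pow (k : ℕ) {s M : ℝ} (hM : 1 ≤ M) (hs : s ≤ M) :
    ∫ t in 0..M, max (s - load t) 0 ^ (k + 1) =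
      (max s 0 ^ (k + 2) - 2 / 3 * max (s - 1) 0 ^ (k + 2)) / (k + 2) := by
  have hcont : Continuous fun t => max (s - load t) 0 ^ (k + 1) :=
    ((continuous_const.sub continuous_load).max continuous_const).pow _
  have h1 : ∫ t in 0..1, max (s - load t) 0 ^ (k + 1) =
      ∫ t in 0..1, max (s - 1 * t) 0 ^ (k + 1) := by
    refine intervalIntegral.integral_congr fun t ht => ?_
    rw [Set.uIcc_of_le zero_le_one] at ht
    simp only [load, one_mul]
    rw [max_eq_left (a := t) (by linarith [ht.2])]
  have h2 : ∫ t in 1..M, max (s - load t) 0 ^ (k + 1) =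
      ∫ t in 1..M, max (s + 2 - 3 * t) 0 ^ (k + 1) := by
    refine intervalIntegral.integral_congr fun t ht => ?_
    rw [Set.uIcc_of_le hM] at ht
    simp only [load]
    rw [max_eq_right (a := t) (by linarith [ht.1])]
    ring_nf
  rw [← intervalIntegral.integral_add_adjacent_intervals (hcont.intervalIntegrable 0 1)
    (hcont.intervalIntegrable 1 M), h1, h2, integral_max_pow k one_ne_zero,
    integral_max_pow k three_ne_zero, max_eq_right (a := s + 2 - 3 * M) (by linarith),
    show s + 2 - 3 * 1 = s - 1 by ring]
  have hk : (k + 2 : ℝ) ≠ 0 := by positivity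
  simp only [mul_zero, sub_zero, mul_one, one_mul, zero_pow (Nat.succ_ne_zero (k + 1))]
  field_simp
  ring

/-! ### Volumes in dimensions 0 to 3 -/

theorem volume_loadRegion_zero (s : ℝ) :
    volume (loadRegion 0 s) = if 0 ≤ s then 1 else 0 := by
  split_ifs with h
  · have : loadRegion 0 s = Set.univ := by ext u; simp [loadRegion, h]
    simp [this, volume_pi]
  · simp [loadRegion_eq_empty (not_le.1 h)]

/-- Computed directly: the volume in dimension 0 jumps at `s = 0`, so the recursion for continuous
`W` starts only from here. -/
theorem volume_loadRegion_one (s : ℝ) :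
    volume (loadRegion 1 s) =
      ENNReal.ofReal (max s 0 - 2 / 3 * max (s - 1) 0) := by
  have hind : ∀ t, volume (loadRegion 0 (s - load t)) =
      (Set.Iic (min s ((s + 2) / 3))).indicator 1 t := by
    intro t
    rw [volume_loadRegion_zero, Set.indicator_apply]
    refine if_congr ?_ rfl rfl
    rw [sub_nonneg, load, max_le_iff, Set.mem_Iic, le_min_iff, le_div_iff₀ three_pos]
    constructor <;> rintro ⟨h1, h2⟩ <;> exact ⟨h1, by linarith⟩
  rw [volume_loadRegion_succ, lintegral_congr hind, lintegral_indicator_one measurableSet_Iic,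
    Measure.restrict_apply measurableSet_Iic, Set.inter_comm, Set.Ici_inter_Iic, Real.volume_Icc]
  rcases le_total s 0 with h0 | h0
  · rw [max_eq_right h0, max_eq_right (by linarith), min_eq_left (by linarith),
      ENNReal.ofReal_of_nonpos (by linarith)]
    simp
  rcases le_total s 1 with h1 | h1
  · rw [max_eq_left h0, max_eq_right (by linarith), min_eq_left (by linarith)]
    ring_nf
  · rw [max_eq_left h0, max_eq_left (by linarith), min_eq_right (by linarith)]
    ring_nf

theorem volume_loadRegion_two (s : ℝ) :
    volume (loadRegion 2 s) = ENNReal.ofReal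
      ((max s 0 ^ 2 - 4 / 3 * max (s - 1) 0 ^ 2 + 4 / 9 * max (s - 2) 0 ^ 2) / 2) := by
  have hM : 1 ≤ max s 1 := le_max_right _ _
  have hs : s ≤ max s 1 := le_max_left _ _
  rw [volume_loadRegion_succ_of_eq (W := fun s => max s 0 - 2 / 3 * max (s - 1) 0) (by fun_prop)
    (fun s => ?_) volume_loadRegion_one (zero_le_one.trans hM) hs]
  · have h1 := integral_max_sub_load_pow 0 hM hs
    have h2 := integral_max_sub_load_pow 0 hM (show s - 1 ≤ max s 1 by linarith)
    simp only [zero_add, pow_one] at h1 h2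
    have hl := continuous_load
    simp only [sub_right_comm s _ (1 : ℝ)]
    rw [intervalIntegral.integral_sub (Continuous.intervalIntegrable (by fun_prop) _ _)
      (Continuous.intervalIntegrable (by fun_prop) _ _), intervalIntegral.integral_const_mul, h1,
      h2, show s - 1 - 1 = s - 2 by ring]
    push_cast
    ring_nf
  · rcases max_cases s 0 with ⟨h, _⟩ | ⟨h, _⟩ <;> rcases max_cases (s - 1) 0 with ⟨h', _⟩ | ⟨h', _⟩
      <;> rw [h, h'] <;> linarith

theorem volume_loadRegion_three (s : ℝ) :
    volume (loadRegion 3 s) = ENNReal.ofReal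
      ((max s 0 ^ 3 - 2 * max (s - 1) 0 ^ 3 + 4 / 3 * max (s - 2) 0 ^ 3
        - 8 / 27 * max (s - 3) 0 ^ 3) / 6) := by
  have hM : 1 ≤ max s 1 := le_max_right _ _
  have hs : s ≤ max s 1 := le_max_left _ _
  rw [volume_loadRegion_succ_of_eq (W := fun s =>
    (max s 0 ^ 2 - 4 / 3 * max (s - 1) 0 ^ 2 + 4 / 9 * max (s - 2) 0 ^ 2) / 2) (by fun_prop)
    (fun s => ?_) volume_loadRegion_two (zero_le_one.trans hM) hs]
  · have h1 := integral_max_sub_load_pow 1 hM hs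
    have h2 := integral_max_sub_load_pow 1 hM (show s - 1 ≤ max s 1 by linarith)
    have h3 := integral_max_sub_load_pow 1 hM (show s - 2 ≤ max s 1 by linarith)
    norm_num only at h1 h2 h3
    have hl := continuous_load
    simp only [sub_right_comm s _ (1 : ℝ), sub_right_comm s _ (2 : ℝ)]
    rw [intervalIntegral.integral_div, intervalIntegral.integral_add
      (Continuous.intervalIntegrable (by fun_prop) _ _)
      (Continuous.intervalIntegrable (by fun_prop) _ _), intervalIntegral.integral_sub
      (Continuous.intervalIntegrable (by fun_prop) _ _)
      (Continuous.intervalIntegrable (by fun_prop) _ _), intervalIntegral.integral_const_mul,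
      intervalIntegral.integral_const_mul, h1, h2, h3, show s - 1 - 1 = s - 2 by ring,
      show s - 2 - 1 = s - 3 by ring]
    ring_nf
  · rcases max_cases s 0 with ⟨h, _⟩ | ⟨h, _⟩ <;> rcases max_cases (s - 1) 0 with ⟨h', _⟩ | ⟨h', _⟩
      <;> rcases max_cases (s - 2) 0 with ⟨h'', _⟩ | ⟨h'', _⟩ <;> rw [h, h', h''] <;> nlinarith

end ServiceRate

theorem mainTheorem8 {F : Type*} [Field F] [Finite F] (n : ℕ) (hn : 6 ≤ n)
    (G : Matrix (Fin 3) (Fin n) F) (hMDS : ServiceRate.IsMDS G)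
    (hsys : ServiceRate.IsSystematic G) :
    ServiceRate.vol (ServiceRate.matrixRegion G) =
      ENNReal.ofReal (((n : ℝ) ^ 3 + 18 * (n : ℝ) ^ 2 + 54 * (n : ℝ) - 18) / 162) := by
  have h6 : (6 : ℝ) ≤ n := by exact_mod_cast hn
  rw [ServiceRate.matrixRegion_eq_loadRegion hn hMDS hsys, ServiceRate.vol_loadRegion,
    ServiceRate.volume_loadRegion_three, max_eq_left (by linarith), max_eq_left (by linarith),
    max_eq_left (by linarith), max_eq_left (by linarith)]
  ring_nf
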